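/- **Setting.** Let $p\ge 1$. For $h>0$ let $x_i=ih$ ($i\in\mathbb Z$) be the uniform grid of $\mathbb R$ with elements $K_e=[eh,(e+1)h]$, and let $\theta^j_p$, $j\in\mathbb Z$, be the B-splines of degree $p$ on it, defined by the Cox–de Boor recursion: $\theta^j_0=1_{[x_j,x_{j+1})}$ and $$\theta^j_p(x)=\frac{x-x_j}{x_{j+p}-x_j}\,\theta^j_{p-1}(x)+\frac{x_{j+p+1}-x}{x_{j+p+1}-x_{j+1}}\,\theta^{j+1}_{p-1}(x).$$ Let $Q_p$ be a quadrature rule $\int_0^1 f\approx\sum_{l=1}^{N_q}\varpi_l f(n_l)$, with nodes $n_l\in[0,1]$ and real weights $\varpi_l$, that integrates all polynomials of degree at most $2p-2$ exactly. Put $$a_h(w,v)=\sum_e\sum_l h\varpi_l\,w'(n_{l,e})v'(n_{l,e}),\qquad b_h(w,v)=\sum_e\sum_l h\varpi_l\,w(n_{l,e})v(n_{l,e}),\qquad n_{l,e}=(e+n_l)h,$$ where the derivatives are those of the restrictions to the closed element $K_e$, and $$\tilde A^{j+k}_{p,Q_p}=a_h(\theta^{j+k}_p,\theta^j_p)\,h,\qquad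 \tilde B^{j+k}_{p,Q_p}=b_h(\theta^{j+k}_p,\theta^j_p)/h .$$ **Theorem.** (i) (Generic frequency.) Let $\mu\in\mathbb R$ and $\lambda=\mu^2$. For all sufficiently small $h>0$ there is exactly one number $\tilde\lambda^h_{p,Q_p}\in\mathbb C$ for which the Bloch wave $U^k=e^{ik\mu h}$ solves $$\sum_{k}a_h(\theta^j_p,\theta^k_p)\,U^k=\tilde\lambda^h_{p,Q_p}\sum_{k}b_h(\theta^j_p,\theta^k_p)\,U^k\qquad\text{for all } j\in\mathbb Z;$$ this number is real and, for every $j$, as $h\to0^+$, $$\tilde\lambda^h_{p,Q_p}-\lambda=2(-1)^{p+1}\Big(\sum_{k=1}^p\Big[\frac{k^{2p+2}}{(2p+2)!}\tilde A^{j+k}_{p,Q_p}+\frac{k^{2p}}{(2p)!}\tilde B^{j+k}_{p,Q_p}\Big]\Big)\mu^{2p+2}h^{2p}+O(h^{2p+2}),$$ where the implied constant may depend on $p$, $Q_p$, $\mu$. (ii) (Periodic eigenvalue problem.) Let $L>0$, let $\lambda$ be an eigenvalue of $-u''=\lambda u$ with $L$-periodic boundary conditions, and let $\mu\in\mathbb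 R$ with $\mu^2=\lambda$. For $N\ge1$ let $h=L/N$, let $\varphi_a=\sum_{m\in\mathbb Z}\theta^{a+mN}_p$ ($0\le a<N$) be the periodic B-splines, and let $\mathbf K$, $\mathbf M$ be the $N\times N$ matrices with entries $a_h(\varphi_a,\varphi_b)$, $b_h(\varphi_a,\varphi_b)$, where $a_h$, $b_h$ are now summed over the $N$ elements of $[0,L]$ only. For all sufficiently large $N$ there is exactly one $\tilde\lambda^h_{p,Q_p}\in\mathbb C$ with $\mathbf KU=\tilde\lambda^h_{p,Q_p}\mathbf MU$ for $U=(e^{ia\mu h})_{0\le a<N}$; it is real, and it satisfies the same expansion as $N\to\infty$, with an implied constant that may depend also on $L$. -/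

import Mathlib

open Filter Topology Asymptotics

namespace IGADispersion

noncomputable section

/-- The B-splines of degree `p` over a knot sequence `x`, by the Cox--de Boor recursion;
`bspline x p j` is the `j`-th one. -/
def bspline (x : ℤ → ℝ) : ℕ → ℤ → ℝ → ℝ
  | 0, j, t => if x j ≤ t ∧ t < x (j + 1) then 1 else 0
  | p + 1, j, t =>
      (t - x j) / (x (j + (p + 1)) - x j) * bspline x p j t +
        (x (j + (p + 2)) - t) / (x (j + (p + 2)) - x (j + 1)) * bspline x p (j + 1) t

/-- The `j`-th B-spline of degree `p` and maximal smoothness on the uniform grid `{j h}`. -/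
def spline (p : ℕ) (h : ℝ) (j : ℤ) : ℝ → ℝ := bspline (fun i => (i : ℝ) * h) p j

/-- A quadrature rule on the reference element `[0,1]`: finitely many nodes of the element, with
arbitrary real weights. -/
structure QuadratureRule where
  size : ℕ
  node : Fin size → ℝ
  weight : Fin size → ℝ
  node_mem : ∀ l, node l ∈ Set.Icc (0 : ℝ) 1

/-- The rule integrates all polynomials of degree at most `m` exactly. -/
def QuadratureRule.ExactUpTo (Q : QuadratureRule) (m : ℕ) : Prop :=
  ∀ P : Polynomial ℝ, P.natDegree ≤ m →
    ∑ l, Q.weight l * P.eval (Q.node l) = ∫ t in (0 : ℝ)..1, P.eval t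

/-- The `e`-th element of the uniform grid of size `h`. -/
def element (h : ℝ) (e : ℤ) : Set ℝ := Set.Icc ((e : ℝ) * h) (((e : ℝ) + 1) * h)

/-- The `l`-th node of the rule, mapped affinely to the `e`-th element. -/
def mappedNode (Q : QuadratureRule) (h : ℝ) (e : ℤ) (l : Fin Q.size) : ℝ :=
  ((e : ℝ) + Q.node l) * h

/-- Contribution of the `e`-th element to the quadrature approximation of `∫ w' v'`. The
derivatives are those of the restrictions to the closed element (hence one-sided at a node that is
an end point of the element, where they may jump if the degree is one). -/
def elementStiffness (Q : QuadratureRule) (h : ℝ) (e : ℤ) (w v : ℝ → ℝ) : ℝ :=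
  ∑ l, h * Q.weight l * (derivWithin w (element h e) (mappedNode Q h e l) *
    derivWithin v (element h e) (mappedNode Q h e l))

/-- Contribution of the `e`-th element to the quadrature approximation of `∫ w v`. -/
def elementMass (Q : QuadratureRule) (h : ℝ) (e : ℤ) (w v : ℝ → ℝ) : ℝ :=
  ∑ l, h * Q.weight l * (w (mappedNode Q h e l) * v (mappedNode Q h e l))

/-- The form `a_h` on the whole uniform grid (for compactly supported `w`, a finite sum). -/
def aForm (Q : QuadratureRule) (h : ℝ) (w v : ℝ → ℝ) : ℝ := ∑ᶠ e : ℤ, elementStiffness Q h e w v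

/-- The form `b_h` on the whole uniform grid (for compactly supported `w`, a finite sum). -/
def bForm (Q : QuadratureRule) (h : ℝ) (w v : ℝ → ℝ) : ℝ := ∑ᶠ e : ℤ, elementMass Q h e w v

/-- Normalized stiffness entry between the splines `j + k` and `j`. -/
def stiffnessEntry (Q : QuadratureRule) (p : ℕ) (h : ℝ) (j k : ℤ) : ℝ :=
  aForm Q h (spline p h (j + k)) (spline p h j) * h

/-- Normalized mass entry between the splines `j + k` and `j`. -/
def massEntry (Q : QuadratureRule) (p : ℕ) (h : ℝ) (j k : ℤ) : ℝ :=
  bForm Q h (spline p h (j + k)) (spline p h j) / h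

/-- The Bloch wave coefficients `exp (i j μ h)`. -/
def blochWave (μ h : ℝ) (j : ℤ) : ℂ := Complex.exp (Complex.I * ((j : ℂ) * μ * h))

/-- `ν` is the approximated eigenvalue, on the infinite uniform grid, of the Bloch wave with
frequency `μ`: the wave solves `K U = ν M U`, where `K` and `M` are the stiffness and mass matrices
computed with the rule `Q`. (Each row of these matrices has finitely many nonzero entries.) -/
def IsBlochEigenvalue (Q : QuadratureRule) (p : ℕ) (h μ : ℝ) (ν : ℂ) : Prop :=
  ∀ j : ℤ,
    ∑ᶠ k : ℤ, (aForm Q h (spline p h j) (spline p h k) : ℂ) * blochWave μ h k =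
      ν * ∑ᶠ k : ℤ, (bForm Q h (spline p h j) (spline p h k) : ℂ) * blochWave μ h k

/-- `lam` is an eigenvalue of `- u'' = lam u` with `L`-periodic boundary conditions. -/
def IsPeriodicEigenvalue (L lam : ℝ) : Prop :=
  ∃ u : ℝ → ℝ, u ≠ 0 ∧ ContDiff ℝ 2 u ∧ Function.Periodic u L ∧
    ∀ x, - deriv (deriv u) x = lam * u x

/-- The B-spline basis functions of the periodic problem with `N` elements. -/
def periodicSpline (p N : ℕ) (h : ℝ) (a : Fin N) : ℝ → ℝ := fun t =>
  ∑ᶠ m : ℤ, spline p h (((a : ℕ) : ℤ) + m * N) t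

/-- Stiffness matrix of the periodic problem on the `N` elements of `[0, L]`. -/
def periodicStiffness (Q : QuadratureRule) (p N : ℕ) (L : ℝ) : Matrix (Fin N) (Fin N) ℝ :=
  Matrix.of fun a b => ∑ e ∈ Finset.range N,
    elementStiffness Q (L / N) (e : ℤ) (periodicSpline p N (L / N) a)
      (periodicSpline p N (L / N) b)

/-- Mass matrix of the periodic problem on the `N` elements of `[0, L]`. -/
def periodicMass (Q : QuadratureRule) (p N : ℕ) (L : ℝ) : Matrix (Fin N) (Fin N) ℝ :=
  Matrix.of fun a b => ∑ e ∈ Finset.range N,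
    elementMass Q (L / N) (e : ℤ) (periodicSpline p N (L / N) a)
      (periodicSpline p N (L / N) b)

/-- `ν` is the eigenvalue of the periodic matrix problem `K U = ν M U` that belongs to the
eigenvector `U a = exp (i a μ h)`, `h = L / N`. -/
def IsPeriodicApproxEigenvalue (Q : QuadratureRule) (p N : ℕ) (L μ : ℝ) (ν : ℂ) : Prop :=
  ((periodicStiffness Q p N L).map Complex.ofReal).mulVec
      (fun a => blochWave μ (L / N) ((a : ℕ) : ℤ)) =
    ν • ((periodicMass Q p N L).map Complex.ofReal).mulVec
      (fun a => blochWave μ (L / N) ((a : ℕ) : ℤ))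

/-- The leading term of the eigenvalue error:
`2 (-1)^(p+1) (∑ k, k^(2p+2)/(2p+2)! A^(j+k) + k^(2p)/(2p)! B^(j+k)) μ^(2p+2) h^(2p)`. -/
def leadingError (Q : QuadratureRule) (p : ℕ) (h : ℝ) (j : ℤ) (μ : ℝ) : ℝ :=
  2 * (-1) ^ (p + 1) *
    (∑ k ∈ Finset.Icc 1 p,
      ((k : ℝ) ^ (2 * p + 2) / (Nat.factorial (2 * p + 2) : ℝ) * stiffnessEntry Q p h j k +
        (k : ℝ) ^ (2 * p) / (Nat.factorial (2 * p) : ℝ) * massEntry Q p h j k)) *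
    μ ^ (2 * p + 2) * h ^ (2 * p)

end

end IGADispersion

open IGADispersion

namespace IGADispersion

noncomputable section

open Polynomial Finset

/-! Translation invariance makes the stiffness and mass operators discrete convolutions, on the line
as well as on the circle, so a Bloch wave diagonalizes both. With `ω = μ h` its eigenvalue is `A(ω)
/ (h² B(ω))`, where `A` and `B` are the cosine polynomials (`symbol`) of the two Gram sequences.
Since `B(ω) → 1`, the quotient is eventually well defined, real and the only candidate, and
everything reduces to expanding `A(ω) - ω² B(ω)` at `0`.

The Taylor coefficients are quadratures of `correlation p P r`, the sum of `(e - i)^r P_i P_e` over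
pairs of pieces. Writing `e - i = (x + e) - (x + i)` turns these into binomial sums of products of
moments. The `s`-th B-spline moment has degree at most `s`, not `s + p`, and is constant for `s ≤
p`. Hence the mass correlation of order `r` has degree at most `r`, the stiffness correlation has
degree at most `2p - 2`, and exactness to degree `2p - 2` replaces quadrature by integration in
every coefficient that has to cancel.

For integrals, `integral01_correlation_derivative` matches order `r + 2` of the stiffness with order
`r` of the mass as long as `r + 2 ≤ 2p`; it integrates by parts over a period. So `A - ω² B` starts
at `ω^(2p+2)`, and its coefficient there, folded by the evenness of the Gram sequences, is the
stated leading term. -/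

/-! ### Polynomial pieces of the cardinal B-spline -/

/-- The polynomial `x ↦ θ (x + i)` on `[0, 1]`, where `θ` is the cardinal B-spline of degree `p`
supported in `[0, p + 1]`. -/
def splinePiece : ℕ → ℤ → ℝ[X]
  | 0, i => if i = 0 then 1 else 0
  | p + 1, i => C ((p + 1 : ℝ)⁻¹) * ((X + C (i : ℝ)) * splinePiece p i +
      (C ((p : ℝ) + 2 - i) - X) * splinePiece p (i - 1))

lemma splinePiece_eq_zero {p : ℕ} : ∀ {i : ℤ}, ¬ (0 ≤ i ∧ i ≤ p) → splinePiece p i = 0 := by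
  induction p with
  | zero => intro i hi; rw [splinePiece, if_neg]; rintro rfl; simp at hi
  | succ p ih =>
    intro i hi
    by_cases h0 : i < 0
    · rw [splinePiece, ih (by omega), ih (by omega)]; simp
    by_cases h1 : i = p + 1
    · exfalso; apply hi; push_cast; omega
    · rw [splinePiece, ih (by push_cast at hi; omega), ih (by push_cast at hi; omega)]; simp

lemma natDegree_splinePiece_le (p : ℕ) : ∀ i : ℤ, (splinePiece p i).natDegree ≤ p := by
  induction p with
  | zero => intro i; rw [splinePiece]; split_ifs <;> simp
  | succ p ih =>
    intro i
    rw [splinePiece]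
    refine (natDegree_C_mul_le _ _).trans (natDegree_add_le_of_degree_le ?_ ?_)
    · refine natDegree_mul_le.trans ?_
      have := ih i
      rw [natDegree_X_add_C]; omega
    · refine natDegree_mul_le.trans ?_
      have := ih (i - 1)
      have h2 : (C ((p : ℝ) + 2 - i) - X).natDegree ≤ 1 := by
        refine (natDegree_sub_le _ _).trans ?_
        exact max_le ((natDegree_C _).trans_le zero_le_one) natDegree_X_le
      omega

/-- Continuity of the cardinal B-spline at the knots, which fails for degree zero. -/
lemma splinePiece_eval_one {p : ℕ} (hp : 1 ≤ p) :
    ∀ i : ℤ, (splinePiece p i).eval 1 = (splinePiece p (i + 1)).eval 0 := by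
  induction p, hp using Nat.le_induction with
  | base =>
    intro i
    simp only [splinePiece]
    by_cases h0 : i = 0
    · subst h0; norm_num
    by_cases h1 : i = 1
    · subst h1; norm_num
    by_cases h2 : i = -1
    · subst h2; norm_num
    · rw [if_neg h0, if_neg (by omega), if_neg (by omega), if_neg (by omega)]; simp
  | succ p hp ih =>
    intro i
    have h := ih (i - 1)
    rw [sub_add_cancel] at h
    simp only [splinePiece, eval_mul, eval_add, eval_sub, eval_C, eval_X, add_sub_cancel_right,
      ih i, h]
    push_cast
    ring

/-! ### Moments of the cardinal B-spline -/

/-- Moment polynomials of the cardinal B-spline. -/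
def moment (p s : ℕ) : ℝ[X] :=
  ∑ i ∈ range (p + 1), (X + C (i : ℝ)) ^ s * splinePiece p (i : ℤ)

lemma moment_zero_degree (s : ℕ) : moment 0 s = X ^ s := by
  simp [moment, splinePiece]

/-- By Cox–de Boor, piece `i` of degree `p` feeds pieces `i` and `i + 1` of degree `p + 1`. With `y
= X + i` its total weight is `y^(s+1) + (p + 1 - y)(y + 1)^s`, in which `y^(s+1)` cancels: no moment
of order above `s` appears. -/
lemma moment_succ (p s : ℕ) : C (p + 1 : ℝ) * moment (p + 1) s =
    ∑ t ∈ range (s + 1), C ((p + 1 : ℝ) * (s.choose t)) * moment p t -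
      ∑ t ∈ range s, C (s.choose t : ℝ) * moment p (t + 1) := by
  have hbin : ∀ y : ℝ[X], y ^ (s + 1) + (C (p + 1 : ℝ) - y) * (y + 1) ^ s =
      ∑ t ∈ range (s + 1), C ((p + 1 : ℝ) * (s.choose t)) * y ^ t -
      ∑ t ∈ range s, C (s.choose t : ℝ) * y ^ (t + 1) := by
    intro y
    have h1 : (y + 1) ^ s = ∑ t ∈ range (s + 1), C (s.choose t : ℝ) * y ^ t := by
      rw [add_pow]
      refine sum_congr rfl fun t _ => ?_
      rw [one_pow, mul_one, mul_comm, map_natCast]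
    have h2 : ∑ t ∈ range s, C (s.choose t : ℝ) * y ^ (t + 1) = y * ((y + 1) ^ s - y ^ s) := by
      rw [h1, sum_range_succ, Nat.choose_self, Nat.cast_one, C_1, one_mul, add_sub_cancel_right,
        mul_sum]
      exact sum_congr rfl fun t _ => by ring
    have h3 : ∑ t ∈ range (s + 1), C ((p + 1 : ℝ) * (s.choose t)) * y ^ t =
        C (p + 1 : ℝ) * (y + 1) ^ s := by
      rw [h1, mul_sum]
      exact sum_congr rfl fun t _ => by rw [C_mul]; ring
    rw [h2, h3]; ring
  have hpos : (p + 1 : ℝ) ≠ 0 := by positivity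
  have hL : C (p + 1 : ℝ) * moment (p + 1) s = ∑ i ∈ range (p + 1),
      ((X + C (i : ℝ)) ^ (s + 1) + (C (p + 1 : ℝ) - (X + C (i : ℝ))) * (X + C (i : ℝ) + 1) ^ s) *
        splinePiece p (i : ℤ) := by
    have : C (p + 1 : ℝ) * moment (p + 1) s =
        ∑ i ∈ range (p + 1 + 1), (X + C (i : ℝ)) ^ (s + 1) * splinePiece p (i : ℤ) +
        ∑ i ∈ range (p + 1 + 1), (X + C (i : ℝ)) ^ s * ((C ((p : ℝ) + 2 - i) - X) *
          splinePiece p ((i : ℤ) - 1)) := by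
      rw [moment, mul_sum, ← sum_add_distrib]
      refine sum_congr rfl fun i _ => ?_
      have hc : C (p + 1 : ℝ) * C ((p + 1 : ℝ)⁻¹) = 1 := by
        rw [← C_mul, mul_inv_cancel₀ hpos, C_1]
      rw [splinePiece]
      push_cast
      linear_combination ((X + C (i : ℝ)) ^ s * ((X + C (i : ℝ)) * splinePiece p (i : ℤ) +
        (C ((p : ℝ) + 2 - i) - X) * splinePiece p ((i : ℤ) - 1))) * hc
    rw [this, sum_range_succ, splinePiece_eq_zero (by push_cast; omega), mul_zero, add_zero,
      sum_range_succ' (fun i : ℕ => (X + C (i : ℝ)) ^ s * ((C ((p : ℝ) + 2 - i) - X) *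
          splinePiece p ((i : ℤ) - 1))), splinePiece_eq_zero (i := ((0 : ℕ) : ℤ) - 1) (by simp),
      mul_zero, mul_zero, add_zero, ← sum_add_distrib]
    refine sum_congr rfl fun i _ => ?_
    have e : (((i + 1 : ℕ) : ℤ) - 1) = i := by push_cast; ring
    rw [e]
    simp only [Nat.cast_add, Nat.cast_one, C_add, C_sub, C_1, map_natCast, C_ofNat]
    ring
  rw [hL]
  simp_rw [hbin, moment, mul_sum, sub_mul, sum_mul, sum_sub_distrib]
  congr 1
  · rw [sum_comm]
    exact sum_congr rfl fun t _ => sum_congr rfl fun i _ => by ring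
  · rw [sum_comm]
    exact sum_congr rfl fun t _ => sum_congr rfl fun i _ => by ring

lemma moment_succ_eq (p s : ℕ) : moment (p + 1) s = C ((p + 1 : ℝ)⁻¹) *
    (∑ t ∈ range (s + 1), C ((p + 1 : ℝ) * (s.choose t)) * moment p t -
      ∑ t ∈ range s, C (s.choose t : ℝ) * moment p (t + 1)) := by
  have hpos : (p + 1 : ℝ) ≠ 0 := by positivity
  rw [← moment_succ, ← mul_assoc, ← C_mul, inv_mul_cancel₀ hpos, C_1, one_mul]

lemma natDegree_moment_le (p : ℕ) : ∀ s, (moment p s).natDegree ≤ s := by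
  induction p with
  | zero => intro s; rw [moment_zero_degree]; simp
  | succ p ih =>
    intro s
    rw [moment_succ_eq]
    refine (natDegree_C_mul_le _ _).trans ((natDegree_sub_le _ _).trans (max_le ?_ ?_))
    · refine natDegree_sum_le_of_forall_le _ _ fun t ht => (natDegree_C_mul_le _ _).trans ?_
      have := ih t; have := mem_range.1 ht; omega
    · refine natDegree_sum_le_of_forall_le _ _ fun t ht => (natDegree_C_mul_le _ _).trans ?_
      have := ih (t + 1); have := mem_range.1 ht; omega

/-- The infinitesimal form of polynomial reproduction: moments of order at most `p` are constant. -/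
lemma derivative_moment (p : ℕ) : ∀ s ≤ p, derivative (moment p s) = 0 := by
  induction p with
  | zero => intro s hs; obtain rfl : s = 0 := by omega
            rw [moment_zero_degree]; simp
  | succ p ih =>
    intro s hs
    rw [moment_succ_eq, derivative_C_mul, derivative_sub, derivative_sum, derivative_sum]
    rcases Nat.lt_or_ge s (p + 1) with h | h
    · rw [sum_eq_zero, sum_eq_zero]
      · simp
      · intro t ht; have := mem_range.1 ht; rw [derivative_C_mul, ih _ (by omega), mul_zero]
      · intro t ht; have := mem_range.1 ht; rw [derivative_C_mul, ih _ (by omega), mul_zero]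
    -- Only the two terms containing `moment p (p + 1)` can be nonconstant; their coefficients are
    -- both `p + 1`, since `(p + 1).choose p = p + 1`, and they cancel.
    · obtain rfl : s = p + 1 := by omega
      rw [sum_range_succ, sum_eq_zero, sum_range_succ, sum_eq_zero]
      · rw [Nat.choose_self, Nat.choose_succ_self_right]
        simp
      · intro t ht; have := mem_range.1 ht; rw [derivative_C_mul, ih _ (by omega), mul_zero]
      · intro t ht; have := mem_range.1 ht; rw [derivative_C_mul, ih _ (by omega), mul_zero]

lemma moment_zero (p : ℕ) : moment p 0 = 1 := by
  induction p with
  | zero => simp [moment_zero_degree]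
  | succ p ih =>
    rw [moment_succ_eq]
    have hpos : (p + 1 : ℝ) ≠ 0 := by positivity
    simp only [zero_add, range_one, sum_singleton, Nat.choose_self, Nat.cast_one, mul_one, ih,
      range_zero, sum_empty, sub_zero, ← C_mul, inv_mul_cancel₀ hpos, C_1]

/-- Continuity at the knots shifts the summation index by one, and the two boundary terms vanish.
This periodicity removes the boundary terms of later integrations. -/
lemma moment_eval_one {p : ℕ} (hp : 1 ≤ p) (s : ℕ) :
    (moment p s).eval 1 = (moment p s).eval 0 := by
  have h0 : (splinePiece p 0).eval 0 = 0 := by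
    have := splinePiece_eval_one hp (-1)
    rw [splinePiece_eq_zero (by omega)] at this
    simpa using this.symm
  have h1 : splinePiece p ((p + 1 : ℕ) : ℤ) = 0 := splinePiece_eq_zero (by push_cast; omega)
  have hsum := (sum_range_succ' (fun i : ℕ => (i : ℝ) ^ s * (splinePiece p i).eval 0) (p + 1)).symm.trans
    (sum_range_succ _ (p + 1))
  simp only [h1, Nat.cast_zero, h0, eval_zero, mul_zero, add_zero] at hsum
  simp only [moment, eval_finsetSum, eval_mul, eval_pow, eval_add, eval_X, eval_C,
    splinePiece_eval_one hp, zero_add]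
  rw [← hsum]
  refine sum_congr rfl fun i _ => ?_
  push_cast
  rw [add_comm (1 : ℝ)]

/-! ### Moments of the derivative -/

/-- Derivatives of the pieces of the cardinal B-spline. -/
def derivPiece (p : ℕ) (i : ℤ) : ℝ[X] := derivative (splinePiece p i)

lemma derivPiece_eq_zero {p : ℕ} {i : ℤ} (hi : ¬ (0 ≤ i ∧ i ≤ p)) : derivPiece p i = 0 := by
  rw [derivPiece, splinePiece_eq_zero hi, derivative_zero]

/-- Moment polynomials of the derivative of the cardinal B-spline. -/
def derivMoment (p s : ℕ) : ℝ[X] :=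
  ∑ i ∈ range (p + 1), (X + C (i : ℝ)) ^ s * derivPiece p (i : ℤ)

lemma derivMoment_eq (p s : ℕ) :
    derivMoment p s = derivative (moment p s) - C (s : ℝ) * moment p (s - 1) := by
  rw [moment, moment, derivMoment, derivative_sum, mul_sum, ← sum_sub_distrib]
  refine sum_congr rfl fun i _ => ?_
  rw [derivPiece, derivative_mul, derivative_X_add_C_pow]
  ring

/-- Integration of polynomials over the unit interval. -/
def integral01 : ℝ[X] →ₗ[ℝ] ℝ where
  toFun P := ∫ t in (0 : ℝ)..1, P.eval t
  map_add' P R := by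
    simp only [eval_add]
    exact intervalIntegral.integral_add (P.continuous.intervalIntegrable _ _)
      (R.continuous.intervalIntegrable _ _)
  map_smul' c P := by
    simp only [eval_smul, smul_eq_mul, RingHom.id_apply]
    exact intervalIntegral.integral_const_mul _ _

lemma integral01_derivative (P : ℝ[X]) :
    integral01 (derivative P) = P.eval 1 - P.eval 0 :=
  intervalIntegral.integral_eq_sub_of_hasDerivAt (fun x _ => P.hasDerivAt x)
    ((derivative P).continuous.intervalIntegrable _ _)

lemma integral01_C_mul (c : ℝ) (P : ℝ[X]) : integral01 (C c * P) = c * integral01 P := by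
  rw [← smul_eq_C_mul, map_smul, smul_eq_mul]

lemma integral01_derivMoment_mul {p : ℕ} (hp : 1 ≤ p) {s t : ℕ} (h : s + t ≤ 2 * p) :
    integral01 (derivMoment p s * derivMoment p t) =
      s * t * integral01 (moment p (s - 1) * moment p (t - 1)) := by
  -- The smaller index is at most `p`, so its moments are constant; the surviving derivative
  -- `(moment p t)'` integrates to zero by periodicity.
  wlog hst : s ≤ t generalizing s t with H
  · rw [mul_comm, H (by omega) (by omega), mul_comm (moment p _)]; ring
  have hs : derivative (moment p s) = 0 := derivative_moment p s (by omega)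
  obtain ⟨c, hc⟩ : ∃ c, moment p (s - 1) = C c := by
    refine ⟨_, eq_C_of_derivative_eq_zero (derivative_moment p (s - 1) (by omega))⟩
  have : derivMoment p s * derivMoment p t =
      C (-s * c) * derivative (moment p t) + C ((s : ℝ) * t) * (moment p (s - 1) * moment p (t - 1)) := by
    rw [derivMoment_eq, derivMoment_eq, hs, hc]
    simp only [C_mul, C_neg]
    ring
  rw [this, map_add, integral01_C_mul, integral01_C_mul, integral01_derivative,
    moment_eval_one hp]
  ring

/-! ### Autocorrelation moments and their cancellation -/

/-- The moments of the autocorrelation of a finite sequence of polynomials. -/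
def correlation (p : ℕ) (P : ℤ → ℝ[X]) (r : ℕ) : ℝ[X] :=
  ∑ i ∈ range (p + 1), ∑ e ∈ range (p + 1), C (((e : ℝ) - i) ^ r) * (P (i : ℤ) * P (e : ℤ))

lemma correlation_eq (p : ℕ) (P : ℤ → ℝ[X]) (r : ℕ) : correlation p P r =
    ∑ s ∈ range (r + 1), C ((-1) ^ (r - s) * (r.choose s : ℝ)) *
      ((∑ i ∈ range (p + 1), (X + C (i : ℝ)) ^ s * P (i : ℤ)) *
        (∑ i ∈ range (p + 1), (X + C (i : ℝ)) ^ (r - s) * P (i : ℤ))) := by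
  have hbin : ∀ i e : ℕ, C (((e : ℝ) - i) ^ r) = ∑ s ∈ range (r + 1),
      C ((-1) ^ (r - s) * (r.choose s : ℝ)) * ((X + C (e : ℝ)) ^ s * (X + C (i : ℝ)) ^ (r - s)) := by
    intro i e
    have : C (((e : ℝ) - i) ^ r) = ((X + C (e : ℝ)) + -(X + C (i : ℝ))) ^ r := by
      rw [C_pow, C_sub]; ring
    rw [this, add_pow]
    refine sum_congr rfl fun s _ => ?_
    rw [neg_pow (X + C (i : ℝ))]
    simp only [C_mul, C_pow, C_neg, C_1, map_natCast]
    ring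
  simp_rw [correlation, hbin, sum_mul, mul_sum]
  have h1 : ∀ i : ℕ, ∑ e ∈ range (p + 1), ∑ s ∈ range (r + 1),
      C ((-1) ^ (r - s) * (r.choose s : ℝ)) * ((X + C (e : ℝ)) ^ s * (X + C (i : ℝ)) ^ (r - s)) *
        (P (i : ℤ) * P (e : ℤ)) = ∑ s ∈ range (r + 1), ∑ e ∈ range (p + 1),
      C ((-1) ^ (r - s) * (r.choose s : ℝ)) * ((X + C (e : ℝ)) ^ s * (X + C (i : ℝ)) ^ (r - s)) *
        (P (i : ℤ) * P (e : ℤ)) := fun i => sum_comm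
  simp_rw [h1]
  rw [sum_comm]
  refine sum_congr rfl fun s _ => ?_
  rw [sum_comm]
  refine sum_congr rfl fun e _ => sum_congr rfl fun i _ => by ring

/-- The orders of the two moments in each binomial term add up to `r`. The piecewise bound `2 * p`
would exceed the exactness of the rule. -/
lemma natDegree_correlation_splinePiece_le (p r : ℕ) :
    (correlation p (splinePiece p) r).natDegree ≤ r := by
  rw [correlation_eq]
  refine natDegree_sum_le_of_forall_le _ _ fun s hs => (natDegree_C_mul_le _ _).trans ?_
  refine natDegree_mul_le.trans ?_
  have h1 := natDegree_moment_le p s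
  have h2 := natDegree_moment_le p (r - s)
  have := mem_range.1 hs
  rw [moment] at h1 h2
  omega

lemma natDegree_correlation_derivative_le (p r : ℕ) :
    (correlation p (derivPiece p) r).natDegree ≤ 2 * p - 2 := by
  refine natDegree_sum_le_of_forall_le _ _ fun i _ =>
    natDegree_sum_le_of_forall_le _ _ fun e _ => (natDegree_C_mul_le _ _).trans ?_
  refine natDegree_mul_le.trans ?_
  have h1 := natDegree_derivative_le (splinePiece p i)
  have h2 := natDegree_derivative_le (splinePiece p e)
  have h3 := natDegree_splinePiece_le p i
  have h4 := natDegree_splinePiece_le p e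
  rw [derivPiece, derivPiece]
  omega

lemma integral01_correlation_derivative_zero {p : ℕ} (hp : 1 ≤ p) :
    integral01 (correlation p (derivPiece p) 0) = 0 := by
  have := integral01_derivMoment_mul hp (s := 0) (t := 0) (by omega)
  simpa [derivMoment, correlation, sum_mul_sum] using this

lemma integral01_correlation_derivative {p : ℕ} (hp : 1 ≤ p) {r : ℕ} (hr : r + 2 ≤ 2 * p) :
    integral01 (correlation p (derivPiece p) (r + 2)) =
      -((r + 2) * (r + 1)) * integral01 (correlation p (splinePiece p) r) := by
  have h1 : integral01 (correlation p (derivPiece p) (r + 2)) =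
      ∑ s ∈ range (r + 3), (-1) ^ (r + 2 - s) * ((r + 2).choose s : ℝ) *
        ((s : ℝ) * ((r + 2 - s : ℕ) : ℝ) *
          integral01 (moment p (s - 1) * moment p (r + 2 - s - 1))) := by
    rw [correlation_eq, map_sum]
    refine sum_congr rfl fun s hs => ?_
    have := mem_range.1 hs
    rw [integral01_C_mul, ← integral01_derivMoment_mul hp (by omega)]
    rfl
  have h2 : integral01 (correlation p (splinePiece p) r) =
      ∑ s ∈ range (r + 1), (-1) ^ (r - s) * (r.choose s : ℝ) *
          integral01 (moment p s * moment p (r - s)) := by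
    rw [correlation_eq, map_sum]
    refine sum_congr rfl fun s hs => ?_
    rw [integral01_C_mul]
    rfl
  -- The end terms `s = 0` and `s = r + 2` carry the factor `s (r + 2 - s)` and vanish; the rest is
  -- matched by `t = s - 1`.
  rw [h1, h2, sum_range_succ', sum_range_succ, mul_sum]
  simp only [Nat.cast_zero, zero_mul, mul_zero, add_zero, Nat.add_sub_cancel]
  have e0 : r + 2 - (r + 1 + 1) = 0 := by omega
  rw [e0]
  simp only [Nat.cast_zero, zero_mul, mul_zero, add_zero]
  refine sum_congr rfl fun t ht => ?_
  have htr := mem_range.1 ht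
  obtain ⟨d, rfl⟩ : ∃ d, r = t + d := ⟨r - t, by omega⟩
  have e1 : t + d + 2 - (t + 1) = d + 1 := by omega
  have e2 : t + d - t = d := by omega
  rw [e1, e2, Nat.add_sub_cancel]
  -- Two absorption identities turn `(r+2).choose (t+1) * (t+1) * (d+1)` into `(r+2) * (r+1) *
  -- r.choose t`.
  have c1 : ((t + d + 2 : ℕ) : ℝ) * ((t + d + 1).choose t : ℝ) =
      ((t + d + 2).choose (t + 1) : ℝ) * ((t + 1 : ℕ) : ℝ) := by
    exact_mod_cast Nat.add_one_mul_choose_eq (t + d + 1) t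
  have c2 : ((t + d).choose t : ℝ) * ((t + d + 1 : ℕ) : ℝ) =
      ((t + d + 1).choose t : ℝ) * ((d + 1 : ℕ) : ℝ) := by
    have := Nat.choose_mul_succ_eq (t + d) t
    rw [show t + d + 1 - t = d + 1 by omega] at this
    exact_mod_cast this
  push_cast at c1 c2 ⊢
  rw [pow_succ]
  linear_combination ((-1) ^ d * integral01 (moment p t * moment p d)) *
    ((d + 1 : ℝ) * c1 + (t + d + 2 : ℝ) * c2)

/-! ### Grid splines restricted to an element -/

lemma spline_succ {h : ℝ} (hh : 0 < h) (p : ℕ) (j e : ℤ) (x : ℝ) :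
    spline (p + 1) h j (((e : ℝ) + x) * h) = ((p + 1 : ℝ)⁻¹) *
      ((x + ((e - j : ℤ) : ℝ)) * spline p h j (((e : ℝ) + x) * h) +
        (((p : ℝ) + 2 - ((e - j : ℤ) : ℝ)) - x) * spline p h (j + 1) (((e : ℝ) + x) * h)) := by
  have hpos : (p + 1 : ℝ) ≠ 0 := by positivity
  have h1 : ((((e : ℝ) + x) * h) - j * h) / (((j + (p + 1) : ℤ) : ℝ) * h - j * h) =
      (p + 1 : ℝ)⁻¹ * (x + ((e - j : ℤ) : ℝ)) := by
    push_cast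
    rw [show ((j : ℝ) + (p + 1)) * h - j * h = (p + 1) * h by ring]
    field_simp
    ring
  have h2 : (((j + (p + 2) : ℤ) : ℝ) * h - (((e : ℝ) + x) * h)) /
      (((j + (p + 2) : ℤ) : ℝ) * h - ((j + 1 : ℤ) : ℝ) * h) =
      (p + 1 : ℝ)⁻¹ * (((p : ℝ) + 2 - ((e - j : ℤ) : ℝ)) - x) := by
    push_cast
    rw [show ((j : ℝ) + (p + 2)) * h - (j + 1) * h = (p + 1) * h by ring]
    field_simp
    ring
  simp only [spline, bspline]
  rw [h1, h2]
  ring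

lemma spline_eq_splinePiece_of_lt {h : ℝ} (hh : 0 < h) {p : ℕ} :
    ∀ (j e : ℤ) {x : ℝ}, 0 ≤ x → x < 1 →
    spline p h j (((e : ℝ) + x) * h) = (splinePiece p (e - j)).eval x := by
  induction p with
  | zero =>
    intro j e x hx0 hx1
    have : ((j : ℝ) * h ≤ ((e : ℝ) + x) * h ∧ ((e : ℝ) + x) * h < ((j + 1 : ℤ) : ℝ) * h) ↔
        e - j = 0 := by
      rw [mul_le_mul_iff_left₀ hh, mul_lt_mul_iff_left₀ hh]
      constructor
      · rintro ⟨h1, h2⟩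
        have h3 : (j : ℝ) < ((e + 1 : ℤ) : ℝ) := by push_cast; linarith
        have h4 : (e : ℝ) < ((j + 1 : ℤ) : ℝ) := by linarith
        rw [Int.cast_lt] at h3 h4
        omega
      · intro h1
        obtain rfl : e = j := by omega
        push_cast
        constructor <;> linarith
    simp only [spline, bspline, splinePiece, this]
    split_ifs <;> simp
  | succ p ih =>
    intro j e x hx0 hx1
    rw [spline_succ hh, ih j e hx0 hx1, ih (j + 1) e hx0 hx1, splinePiece,
      show e - (j + 1) = e - j - 1 by ring]
    simp only [eval_mul, eval_add, eval_sub, eval_C, eval_X]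

lemma spline_eq_splinePiece {h : ℝ} (hh : 0 < h) {p : ℕ} (hp : 1 ≤ p) (j e : ℤ) {x : ℝ}
    (hx : x ∈ Set.Icc (0 : ℝ) 1) :
    spline p h j (((e : ℝ) + x) * h) = (splinePiece p (e - j)).eval x := by
  rcases hx.2.lt_or_eq with h1 | rfl
  · exact spline_eq_splinePiece_of_lt hh j e hx.1 h1
  -- Degree-zero splines are half-open, so the right end point is read off the next element, through
  -- continuity.
  · have := spline_eq_splinePiece_of_lt hh (p := p) j (e + 1) le_rfl zero_lt_one
    rw [splinePiece_eval_one hp, show e - j + 1 = e + 1 - j by ring, ← this]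
    push_cast
    rw [add_zero]

lemma mappedNode_mem_element (Q : QuadratureRule) {h : ℝ} (hh : 0 < h) (e : ℤ) (l : Fin Q.size) :
    mappedNode Q h e l ∈ element h e := by
  have := Q.node_mem l
  rw [mappedNode, element]
  constructor
  · exact mul_le_mul_of_nonneg_right (by linarith [this.1]) hh.le
  · exact mul_le_mul_of_nonneg_right (by linarith [this.2]) hh.le

lemma derivWithin_element_eq (Q : QuadratureRule) {h : ℝ} (hh : 0 < h) (e : ℤ) (l : Fin Q.size)
    {w : ℝ → ℝ} {R : ℝ[X]}
    (hw : ∀ x ∈ Set.Icc (0 : ℝ) 1, w (((e : ℝ) + x) * h) = R.eval x) :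
    derivWithin w (element h e) (mappedNode Q h e l) =
      (derivative R).eval (Q.node l) / h := by
  have hEq : Set.EqOn w (fun t => R.eval (t / h - e)) (element h e) := by
    intro t ht
    have h1 : t / h - e ∈ Set.Icc (0 : ℝ) 1 := by
      rw [element] at ht
      constructor
      · have := (le_div_iff₀ hh).2 ht.1; linarith
      · have := (div_le_iff₀ hh).2 ht.2; linarith
    have := hw _ h1
    rwa [add_sub_cancel, div_mul_cancel₀ _ hh.ne'] at this
  have hmem := mappedNode_mem_element Q hh e l
  have hn : mappedNode Q h e l / h - e = Q.node l := by
    rw [mappedNode]; field_simp; ring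
  rw [derivWithin_congr hEq (hEq hmem)]
  have hd : HasDerivAt (fun t => R.eval (t / h - e)) ((derivative R).eval (Q.node l) * (1 / h))
      (mappedNode Q h e l) := by
    have hlin : HasDerivAt (fun t : ℝ => t / h - e) (1 / h) (mappedNode Q h e l) :=
      ((hasDerivAt_id _).div_const h).sub_const _
    have hR := R.hasDerivAt (mappedNode Q h e l / h - e)
    rw [hn] at hR
    exact HasDerivAt.comp (h₂ := fun x => R.eval x) _ (by rw [hn]; exact hR) hlin
  rw [hd.hasDerivWithinAt.derivWithin, mul_one_div]
  refine uniqueDiffOn_Icc ?_ _ hmem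
  nlinarith

/-! ### Finite sums over the integers -/

section Sums

variable {M : Type*} [AddCommMonoid M]

lemma finsum_eq_sum_range_shift {p : ℕ} (j : ℤ) {F : ℤ → M}
    (hF : ∀ e : ℤ, ¬ (0 ≤ e - j ∧ e - j ≤ p) → F e = 0) :
    ∑ᶠ e, F e = ∑ i ∈ range (p + 1), F (j + (i : ℤ)) := by
  rw [finsum_eq_sum_of_support_subset (s := (range (p + 1)).image fun i : ℕ => j + (i : ℤ)),
    sum_image]
  · intro a _ b _ hab
    simpa using hab
  · intro e he
    by_contra hcon
    refine he (hF e fun h => hcon ?_)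
    rw [coe_image]
    exact ⟨(e - j).toNat, by simp only [coe_range, Set.mem_Iio]; omega, by dsimp only; omega⟩

lemma hasFiniteSupport_comp_sub_mul {p N : ℕ} (hN : N ≠ 0) (d : ℤ) {F : ℤ → M}
    (hF : ∀ e : ℤ, ¬ (0 ≤ e ∧ e ≤ p) → F e = 0) :
    Function.HasFiniteSupport fun m : ℤ => F (d - m * N) := by
  have hinj : Function.Injective fun m : ℤ => d - m * N := by
    intro a b hab
    have : a * (N : ℤ) = b * N := by simpa using hab
    exact mul_right_cancel₀ (by exact_mod_cast hN) this
  refine ((Set.finite_Icc (0 : ℤ) p).preimage hinj.injOn).subset fun m hm => ?_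
  by_contra hcon
  exact hm (hF _ fun h => hcon h)

lemma sum_finsum_residue {N : ℕ} (hN : N ≠ 0) {F : ℤ → M} (hF : Function.HasFiniteSupport F) :
    ∑ b : Fin N, ∑ᶠ m : ℤ, F ((b : ℕ) + m * N) = ∑ᶠ k, F k := by
  have : NeZero N := ⟨hN⟩
  have hinj := (Int.divModEquiv N).symm.injective
  rw [← finsum_comp_equiv (Int.divModEquiv N).symm,
    finsum_curry _ (hF.preimage hinj.injOn)]
  simp_rw [finsum_eq_sum_of_fintype]
  rw [finsum_sum_comm]
  · refine sum_congr rfl fun b _ => finsum_congr fun m => ?_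
    rw [Int.divModEquiv_symm_apply, add_comm]
  · intro b _
    refine hF.preimage (f := fun m : ℤ => (Int.divModEquiv N).symm (m, b)) ?_
    intro m _ m' _ hm
    simpa using hinj hm

end Sums

/-! ### Gram sequences and symbols -/

/-- The quadrature functional on the reference element. -/
def QuadratureRule.apply (Q : QuadratureRule) : ℝ[X] →ₗ[ℝ] ℝ where
  toFun P := ∑ l, Q.weight l * P.eval (Q.node l)
  map_add' P R := by simp only [eval_add, mul_add, sum_add_distrib]
  map_smul' c P := by
    simp only [eval_smul, smul_eq_mul, RingHom.id_apply, mul_sum]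
    exact sum_congr rfl fun l _ => by ring

lemma QuadratureRule.apply_def (Q : QuadratureRule) (P : ℝ[X]) :
    Q.apply P = ∑ l, Q.weight l * P.eval (Q.node l) := rfl

/-- Gram sequence of the piecewise polynomial function with pieces `P`. -/
def gram (Q : QuadratureRule) (P : ℤ → ℝ[X]) (d : ℤ) : ℝ := ∑ᶠ e : ℤ, Q.apply (P e * P (e + d))

/-- The trigonometric polynomial whose coefficients are the Gram sequence. -/
def symbol (Q : QuadratureRule) (p : ℕ) (P : ℤ → ℝ[X]) (ω : ℝ) : ℝ :=
  ∑ i ∈ range (p + 1), ∑ e ∈ range (p + 1),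
    Q.apply (P (i : ℤ) * P (e : ℤ)) * Real.cos (((e : ℝ) - i) * ω)

lemma gram_eq_sum (Q : QuadratureRule) {p : ℕ} {P : ℤ → ℝ[X]}
    (hP : ∀ i : ℤ, ¬ (0 ≤ i ∧ i ≤ p) → P i = 0) (d : ℤ) :
    gram Q P d = ∑ i ∈ range (p + 1), Q.apply (P (i : ℤ) * P ((i : ℤ) + d)) := by
  rw [gram, finsum_eq_sum_range_shift (p := p) 0]
  · simp only [zero_add]
  · intro e he
    rw [hP e (by simpa using he), zero_mul, map_zero]

lemma elementStiffness_eq (Q : QuadratureRule) {h : ℝ} (hh : 0 < h) (e : ℤ) {w v : ℝ → ℝ}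
    {R S : ℝ[X]} (hw : ∀ x ∈ Set.Icc (0 : ℝ) 1, w (((e : ℝ) + x) * h) = R.eval x)
    (hv : ∀ x ∈ Set.Icc (0 : ℝ) 1, v (((e : ℝ) + x) * h) = S.eval x) :
    elementStiffness Q h e w v = h⁻¹ * Q.apply (derivative R * derivative S) := by
  rw [elementStiffness, Q.apply_def, mul_sum]
  refine sum_congr rfl fun l _ => ?_
  rw [derivWithin_element_eq Q hh e l hw, derivWithin_element_eq Q hh e l hv, eval_mul]
  field_simp

lemma elementMass_eq (Q : QuadratureRule) {h : ℝ} (e : ℤ) {w v : ℝ → ℝ}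
    {R S : ℝ[X]} (hw : ∀ x ∈ Set.Icc (0 : ℝ) 1, w (((e : ℝ) + x) * h) = R.eval x)
    (hv : ∀ x ∈ Set.Icc (0 : ℝ) 1, v (((e : ℝ) + x) * h) = S.eval x) :
    elementMass Q h e w v = h * Q.apply (R * S) := by
  rw [elementMass, Q.apply_def, mul_sum]
  refine sum_congr rfl fun l _ => ?_
  rw [mappedNode, hw _ (Q.node_mem l), hv _ (Q.node_mem l), eval_mul]
  ring

lemma aForm_spline (Q : QuadratureRule) {h : ℝ} (hh : 0 < h) {p : ℕ} (hp : 1 ≤ p) (j k : ℤ) :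
    aForm Q h (spline p h j) (spline p h k) = h⁻¹ * gram Q (derivPiece p) (j - k) := by
  rw [gram, mul_finsum, aForm, ← finsum_comp_equiv (Equiv.addRight j)]
  refine finsum_congr fun e => ?_
  rw [Equiv.coe_addRight, elementStiffness_eq Q hh _ (fun x hx => spline_eq_splinePiece hh hp j _ hx)
    (fun x hx => spline_eq_splinePiece hh hp k _ hx), add_sub_cancel_right,
    show e + j - k = e + (j - k) by ring]
  rfl

lemma bForm_spline (Q : QuadratureRule) {h : ℝ} (hh : 0 < h) {p : ℕ} (hp : 1 ≤ p) (j k : ℤ) :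
    bForm Q h (spline p h j) (spline p h k) = h * gram Q (splinePiece p) (j - k) := by
  rw [gram, mul_finsum, bForm, ← finsum_comp_equiv (Equiv.addRight j)]
  refine finsum_congr fun e => ?_
  rw [Equiv.coe_addRight, elementMass_eq Q _ (fun x hx => spline_eq_splinePiece hh hp j _ hx)
    (fun x hx => spline_eq_splinePiece hh hp k _ hx), add_sub_cancel_right,
    show e + j - k = e + (j - k) by ring]

lemma stiffnessEntry_eq (Q : QuadratureRule) {h : ℝ} (hh : 0 < h) {p : ℕ} (hp : 1 ≤ p) (j k : ℤ) :
    stiffnessEntry Q p h j k = gram Q (derivPiece p) k := by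
  rw [stiffnessEntry, aForm_spline Q hh hp, add_sub_cancel_left]
  field_simp

lemma massEntry_eq (Q : QuadratureRule) {h : ℝ} (hh : 0 < h) {p : ℕ} (hp : 1 ≤ p) (j k : ℤ) :
    massEntry Q p h j k = gram Q (splinePiece p) k := by
  rw [massEntry, bForm_spline Q hh hp, add_sub_cancel_left]
  field_simp

lemma blochWave_add (μ h : ℝ) (j k : ℤ) :
    blochWave μ h (j + k) = blochWave μ h j * blochWave μ h k := by
  rw [blochWave, blochWave, blochWave, ← Complex.exp_add]
  congr 1
  push_cast
  ring

lemma blochWave_ne_zero (μ h : ℝ) (j : ℤ) : blochWave μ h j ≠ 0 := Complex.exp_ne_zero _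

lemma sum_blochWave_eq_symbol (Q : QuadratureRule) (p : ℕ) (P : ℤ → ℝ[X]) (μ h : ℝ) :
    ∑ i ∈ range (p + 1), ∑ e ∈ range (p + 1),
      (Q.apply (P (i : ℤ) * P (e : ℤ)) : ℂ) * blochWave μ h ((i : ℤ) - e) =
      (symbol Q p P (μ * h) : ℂ) := by
  have hcs : ∀ i e : ℕ, (Q.apply (P (i : ℤ) * P (e : ℤ)) : ℂ) * blochWave μ h ((i : ℤ) - e) =
      ((Q.apply (P (i : ℤ) * P (e : ℤ)) * Real.cos (((e : ℝ) - i) * (μ * h)) : ℝ) : ℂ) +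
      ((Q.apply (P (i : ℤ) * P (e : ℤ)) * Real.sin (((i : ℝ) - e) * (μ * h)) : ℝ) : ℂ) *
        Complex.I := by
    intro i e
    have h1 : Complex.I * ((((i : ℤ) - e : ℤ) : ℂ) * μ * h) =
        ((((i : ℝ) - e) * (μ * h) : ℝ) : ℂ) * Complex.I := by push_cast; ring
    rw [blochWave, h1, Complex.exp_mul_I, ← Complex.ofReal_cos, ← Complex.ofReal_sin,
      ← Real.cos_neg, show -(((i : ℝ) - e) * (μ * h)) = ((e : ℝ) - i) * (μ * h) by ring]
    push_cast
    ring
  -- The sine part is antisymmetric under `i ↔ e`, which makes the symbol real.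
  have hsin : ∑ i ∈ range (p + 1), ∑ e ∈ range (p + 1),
      Q.apply (P (i : ℤ) * P (e : ℤ)) * Real.sin (((i : ℝ) - e) * (μ * h)) = 0 := by
    have : ∑ i ∈ range (p + 1), ∑ e ∈ range (p + 1),
        Q.apply (P (i : ℤ) * P (e : ℤ)) * Real.sin (((i : ℝ) - e) * (μ * h)) =
        -∑ i ∈ range (p + 1), ∑ e ∈ range (p + 1),
        Q.apply (P (i : ℤ) * P (e : ℤ)) * Real.sin (((i : ℝ) - e) * (μ * h)) := by
      conv_lhs => rw [sum_comm]
      simp_rw [← sum_neg_distrib]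
      refine sum_congr rfl fun e _ => sum_congr rfl fun i _ => ?_
      rw [mul_comm (P (i : ℤ)), ← mul_neg, ← Real.sin_neg]
      congr 2
      ring
    linarith
  simp_rw [hcs, sum_add_distrib, ← sum_mul, ← Complex.ofReal_sum]
  rw [hsin, symbol]
  simp

/-- A character is an eigenvector of every convolution; the symbol is the eigenvalue. -/
lemma finsum_gram_mul_blochWave (Q : QuadratureRule) {p : ℕ} {P : ℤ → ℝ[X]}
    (hP : ∀ i : ℤ, ¬ (0 ≤ i ∧ i ≤ p) → P i = 0) (μ h : ℝ) (j : ℤ) :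
    ∑ᶠ k : ℤ, (gram Q P (j - k) : ℂ) * blochWave μ h k =
      blochWave μ h j * symbol Q p P (μ * h) := by
  have hterm : ∀ i : ℕ, ∀ e : ℤ, ¬ (0 ≤ e - 0 ∧ e - 0 ≤ p) →
      (Q.apply (P (i : ℤ) * P e) : ℂ) * blochWave μ h (i + j - e) = 0 := by
    intro i e he
    rw [hP e (by simpa using he), mul_zero, map_zero, Complex.ofReal_zero, zero_mul]
  simp_rw [gram_eq_sum Q hP, Complex.ofReal_sum, sum_mul]
  rw [finsum_sum_comm, ← sum_blochWave_eq_symbol, mul_sum]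
  · refine sum_congr rfl fun i _ => ?_
    rw [← finsum_comp_equiv (Equiv.subLeft ((i : ℤ) + j))]
    simp only [Equiv.subLeft_apply]
    have e1 : ∀ e : ℤ, (i : ℤ) + (j - (i + j - e)) = e := fun e => by ring
    simp_rw [e1]
    rw [finsum_eq_sum_range_shift 0 (hterm i), mul_sum]
    refine sum_congr rfl fun e _ => ?_
    rw [zero_add, show (i : ℤ) + j - e = j + (i - e) by ring, blochWave_add]
    ring
  · intro i _
    refine (Set.finite_Icc ((i : ℤ) + j - p) (i + j)).subset fun k hk => ?_
    by_contra hcon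
    refine hk ?_
    dsimp only
    rw [hP ((i : ℤ) + (j - k)) (by rw [Set.mem_Icc] at hcon; omega), mul_zero, map_zero,
      Complex.ofReal_zero, zero_mul]

lemma blochWave_equation_iff {h A B : ℝ} (hh : 0 < h) (hB : B ≠ 0) {z : ℂ} (hz : z ≠ 0) (ν : ℂ) :
    ((h⁻¹ : ℝ) : ℂ) * (z * A) = ν * ((h : ℂ) * (z * B)) ↔
      ν = ((A / (h ^ 2 * B) : ℝ) : ℂ) := by
  have hh' : (h : ℂ) ≠ 0 := by exact_mod_cast hh.ne'
  have hB' : (B : ℂ) ≠ 0 := by exact_mod_cast hB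
  push_cast
  rw [eq_div_iff (by positivity), ← mul_right_inj' (a := (h : ℂ)⁻¹ * z)
    (b := ν * _) (by positivity)]
  have e : (h : ℂ)⁻¹ * z * (ν * ((h : ℂ) ^ 2 * B)) = ν * ((h : ℂ) * (z * B)) := by field_simp
  rw [e, mul_assoc _ z, eq_comm]

lemma isBlochEigenvalue_iff (Q : QuadratureRule) {h : ℝ} (hh : 0 < h) {p : ℕ} (hp : 1 ≤ p)
    (μ : ℝ) (hB : symbol Q p (splinePiece p) (μ * h) ≠ 0) (ν : ℂ) :
    IsBlochEigenvalue Q p h μ ν ↔ ν = ((symbol Q p (derivPiece p) (μ * h) /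
      (h ^ 2 * symbol Q p (splinePiece p) (μ * h)) : ℝ) : ℂ) := by
  have key : ∀ j : ℤ,
      (∑ᶠ k : ℤ, (aForm Q h (spline p h j) (spline p h k) : ℂ) * blochWave μ h k =
        ν * ∑ᶠ k : ℤ, (bForm Q h (spline p h j) (spline p h k) : ℂ) * blochWave μ h k) ↔
      ν = ((symbol Q p (derivPiece p) (μ * h) /
      (h ^ 2 * symbol Q p (splinePiece p) (μ * h)) : ℝ) : ℂ) := by
    intro j
    simp_rw [aForm_spline Q hh hp, bForm_spline Q hh hp, Complex.ofReal_mul, mul_assoc,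
      ← mul_finsum]
    rw [finsum_gram_mul_blochWave Q (fun i : ℤ => derivPiece_eq_zero),
      finsum_gram_mul_blochWave Q (fun i : ℤ => splinePiece_eq_zero)]
    exact blochWave_equation_iff hh hB (blochWave_ne_zero μ h j) ν
  rw [IsBlochEigenvalue]
  exact ⟨fun H => (key 0).1 (H 0), fun H j => (key j).2 H⟩

/-! ### The periodic matrices -/

/-- The `N`-periodization of a finitely supported sequence of polynomials. -/
def periodize (N : ℕ) (P : ℤ → ℝ[X]) (d : ℤ) : ℝ[X] := ∑ᶠ m : ℤ, P (d - m * N)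

lemma map_periodize {A F : Type*} [AddCommMonoid A] [FunLike F ℝ[X] A]
    [AddMonoidHomClass F ℝ[X] A] (Φ : F) {p N : ℕ} (hN : N ≠ 0) {P : ℤ → ℝ[X]}
    (hP : ∀ i : ℤ, ¬ (0 ≤ i ∧ i ≤ p) → P i = 0) (d : ℤ) :
    Φ (periodize N P d) = ∑ᶠ m : ℤ, Φ (P (d - m * N)) :=
  map_finsum Φ (hasFiniteSupport_comp_sub_mul hN d hP)

/-- Unfolding: against an `N`-periodic weight, one period of a periodization sums to the whole
sequence over `ℤ`. No relation between `p` and `N` is needed, so overlapping wraps do no harm. -/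
lemma sum_map_periodize_sub (Φ : ℝ[X] →+ ℂ) {p N : ℕ} (hN : N ≠ 0) {P : ℤ → ℝ[X]}
    (hP : ∀ i : ℤ, ¬ (0 ≤ i ∧ i ≤ p) → P i = 0) {z : ℤ → ℂ} (hz : ∀ k m : ℤ, z (k + m * N) = z k)
    (s : ℤ) :
    ∑ b : Fin N, Φ (periodize N P (s - (b : ℕ))) * z (b : ℕ) =
      ∑ i ∈ range (p + 1), Φ (P (i : ℤ)) * z (s - i) := by
  have hsupp : ∀ k : ℤ, ¬ (0 ≤ k - 0 ∧ k - 0 ≤ p) → Φ (P k) * z (s - k) = 0 := by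
    intro k hk
    rw [hP k (by simpa using hk), map_zero, zero_mul]
  have hfin : Function.HasFiniteSupport fun k : ℤ => Φ (P (s - k)) * z k := by
    refine (Set.finite_Icc (s - p) s).subset fun k hk => ?_
    by_contra hcon
    refine hk ?_
    dsimp only
    rw [hP (s - k) (by rw [Set.mem_Icc] at hcon; omega), map_zero, zero_mul]
  have h1 : ∑ᶠ k : ℤ, Φ (P (s - k)) * z k = ∑ i ∈ range (p + 1), Φ (P (i : ℤ)) * z (s - i) := by
    rw [← finsum_comp_equiv (Equiv.subLeft s)]
    simp only [Equiv.subLeft_apply, sub_sub_cancel]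
    rw [finsum_eq_sum_range_shift 0 hsupp]
    simp only [zero_add]
  rw [← h1, ← sum_finsum_residue hN hfin]
  refine sum_congr rfl fun b _ => ?_
  rw [map_periodize Φ hN hP, finsum_mul]
  refine finsum_congr fun m => ?_
  rw [hz, sub_sub]

lemma sum_map_periodize (Φ : ℝ[X] →+ ℂ) {p N : ℕ} (hN : N ≠ 0) {P : ℤ → ℝ[X]}
    (hP : ∀ i : ℤ, ¬ (0 ≤ i ∧ i ≤ p) → P i = 0) {z : ℤ → ℂ} (hz : ∀ k m : ℤ, z (k + m * N) = z k)
    (s : ℤ) :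
    ∑ b : Fin N, Φ (periodize N P ((b : ℕ) - s)) * z (b : ℕ) =
      ∑ i ∈ range (p + 1), Φ (P (i : ℤ)) * z (s + i) := by
  have hsupp : ∀ k : ℤ, ¬ (0 ≤ k - s ∧ k - s ≤ p) → Φ (P (k - s)) * z k = 0 := by
    intro k hk
    rw [hP _ hk, map_zero, zero_mul]
  have hfin : Function.HasFiniteSupport fun k : ℤ => Φ (P (k - s)) * z k := by
    refine (Set.finite_Icc s (s + p)).subset fun k hk => ?_
    by_contra hcon
    exact hk (hsupp k (by rw [Set.mem_Icc] at hcon; omega))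
  have h1 : ∑ᶠ k : ℤ, Φ (P (k - s)) * z k = ∑ i ∈ range (p + 1), Φ (P (i : ℤ)) * z (s + i) := by
    rw [finsum_eq_sum_range_shift s hsupp]
    simp only [add_sub_cancel_left]
  rw [← h1, ← sum_finsum_residue hN hfin]
  refine sum_congr rfl fun b _ => ?_
  rw [map_periodize Φ hN hP, finsum_mul, ← finsum_comp_equiv (Equiv.neg ℤ)]
  refine finsum_congr fun m => ?_
  rw [hz, Equiv.neg_apply]
  congr 3
  ring

lemma periodicSpline_eq {h : ℝ} (hh : 0 < h) {p N : ℕ} (hp : 1 ≤ p) (hN : N ≠ 0) (a : Fin N)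
    (e : ℤ) {x : ℝ} (hx : x ∈ Set.Icc (0 : ℝ) 1) :
    periodicSpline p N h a (((e : ℝ) + x) * h) =
      (periodize N (splinePiece p) (e - (a : ℕ))).eval x := by
  rw [← coe_evalRingHom, map_periodize (evalRingHom x) hN (fun i : ℤ => splinePiece_eq_zero),
    periodicSpline]
  refine finsum_congr fun m => ?_
  rw [spline_eq_splinePiece hh hp _ _ hx, coe_evalRingHom, sub_sub]

lemma derivative_periodize_splinePiece {p N : ℕ} (hN : N ≠ 0) (d : ℤ) :
    derivative (periodize N (splinePiece p) d) = periodize N (derivPiece p) d :=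
  map_periodize (derivative : ℝ[X] →ₗ[ℝ] ℝ[X]) hN (fun _ : ℤ => splinePiece_eq_zero) d

lemma periodicStiffness_apply (Q : QuadratureRule) {p N : ℕ} (hp : 1 ≤ p) (hN : N ≠ 0) {L : ℝ}
    (hL : 0 < L) (a b : Fin N) : periodicStiffness Q p N L a b = (L / N)⁻¹ *
      ∑ e : Fin N, Q.apply (periodize N (derivPiece p) ((e : ℕ) - (a : ℕ)) *
        periodize N (derivPiece p) ((e : ℕ) - (b : ℕ))) := by
  have hh : 0 < L / N := div_pos hL (by exact_mod_cast Nat.pos_of_ne_zero hN)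
  rw [periodicStiffness, Matrix.of_apply, sum_range, mul_sum]
  refine sum_congr rfl fun e _ => ?_
  rw [elementStiffness_eq Q hh _ (fun x hx => periodicSpline_eq hh hp hN a _ hx)
    (fun x hx => periodicSpline_eq hh hp hN b _ hx), derivative_periodize_splinePiece hN,
    derivative_periodize_splinePiece hN]

lemma periodicMass_apply (Q : QuadratureRule) {p N : ℕ} (hp : 1 ≤ p) (hN : N ≠ 0) {L : ℝ}
    (hL : 0 < L) (a b : Fin N) : periodicMass Q p N L a b = (L / N) *
      ∑ e : Fin N, Q.apply (periodize N (splinePiece p) ((e : ℕ) - (a : ℕ)) *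
        periodize N (splinePiece p) ((e : ℕ) - (b : ℕ))) := by
  have hh : 0 < L / N := div_pos hL (by exact_mod_cast Nat.pos_of_ne_zero hN)
  rw [periodicMass, Matrix.of_apply, sum_range, mul_sum]
  refine sum_congr rfl fun e _ => ?_
  rw [elementMass_eq Q _ (fun x hx => periodicSpline_eq hh hp hN a _ hx)
    (fun x hx => periodicSpline_eq hh hp hN b _ hx)]

/-- The additive map `R ↦ Q.apply (S * R)` with complex values. -/
def QuadratureRule.applyMul (Q : QuadratureRule) (S : ℝ[X]) : ℝ[X] →+ ℂ :=
  Complex.ofRealHom.toAddMonoidHom.comp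
    (Q.apply.toAddMonoidHom.comp (AddMonoidHom.mulLeft S))

lemma QuadratureRule.applyMul_apply (Q : QuadratureRule) (S R : ℝ[X]) :
    Q.applyMul S R = (Q.apply (S * R) : ℂ) := rfl

/-- Unfolding is applied twice, first to the column index `b` and then to the element index `e`;
this leaves the same symbol as on the line. -/
lemma sum_periodize_mul_blochWave (Q : QuadratureRule) {p N : ℕ} (hN : N ≠ 0) {P : ℤ → ℝ[X]}
    (hP : ∀ i : ℤ, ¬ (0 ≤ i ∧ i ≤ p) → P i = 0) {μ h : ℝ}
    (hz : ∀ k m : ℤ, blochWave μ h (k + m * N) = blochWave μ h k) (a : ℤ) :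
    ∑ b : Fin N, (∑ e : Fin N, (Q.apply (periodize N P ((e : ℕ) - a) *
        periodize N P ((e : ℕ) - (b : ℕ))) : ℂ)) * blochWave μ h (b : ℕ) =
      blochWave μ h a * symbol Q p P (μ * h) := by
  simp_rw [sum_mul]
  rw [sum_comm]
  simp_rw [← Q.applyMul_apply, sum_map_periodize_sub (Q.applyMul _) hN hP hz]
  rw [sum_comm]
  simp_rw [Q.applyMul_apply, mul_comm (periodize N P _), ← Q.applyMul_apply]
  have hz' : ∀ i : ℕ, ∀ k m : ℤ, blochWave μ h (k + m * N - i) = blochWave μ h (k - i) := by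
    intro i k m
    rw [show k + m * N - i = k - i + m * N by ring, hz]
  have hrow := fun i : ℕ => sum_map_periodize (Q.applyMul (P i)) hN hP
    (z := fun k => blochWave μ h (k - i)) (hz' i) a
  simp_rw [hrow]
  rw [← sum_blochWave_eq_symbol, mul_sum, sum_comm]
  refine sum_congr rfl fun i _ => ?_
  rw [mul_sum]
  refine sum_congr rfl fun e _ => ?_
  rw [Q.applyMul_apply, mul_comm (P (e : ℤ)), show a + (i : ℤ) - e = a + (i - e) by ring,
    blochWave_add]
  ring

lemma isPeriodicApproxEigenvalue_iff (Q : QuadratureRule) {p N : ℕ} (hp : 1 ≤ p) (hN : N ≠ 0)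
    {L μ : ℝ} (hL : 0 < L)
    (hz : ∀ k m : ℤ, blochWave μ (L / N) (k + m * N) = blochWave μ (L / N) k)
    (hB : symbol Q p (splinePiece p) (μ * (L / N)) ≠ 0) (ν : ℂ) :
    IsPeriodicApproxEigenvalue Q p N L μ ν ↔ ν = ((symbol Q p (derivPiece p) (μ * (L / N)) /
      ((L / N) ^ 2 * symbol Q p (splinePiece p) (μ * (L / N))) : ℝ) : ℂ) := by
  have hh : 0 < L / N := div_pos hL (by exact_mod_cast Nat.pos_of_ne_zero hN)
  have key : ∀ a : Fin N,
      ((((periodicStiffness Q p N L).map Complex.ofReal).mulVec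
        (fun a => blochWave μ (L / N) ((a : ℕ) : ℤ))) a =
      (ν • ((periodicMass Q p N L).map Complex.ofReal).mulVec
        (fun a => blochWave μ (L / N) ((a : ℕ) : ℤ))) a) ↔
      ν = ((symbol Q p (derivPiece p) (μ * (L / N)) /
      ((L / N) ^ 2 * symbol Q p (splinePiece p) (μ * (L / N))) : ℝ) : ℂ) := by
    intro a
    rw [Pi.smul_apply, smul_eq_mul]
    simp only [Matrix.mulVec, dotProduct, Matrix.map_apply, periodicStiffness_apply Q hp hN hL,
      periodicMass_apply Q hp hN hL, Complex.ofReal_mul, Complex.ofReal_sum, mul_assoc, ← mul_sum]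
    rw [sum_periodize_mul_blochWave Q hN (fun i : ℤ => derivPiece_eq_zero) hz,
      sum_periodize_mul_blochWave Q hN (fun i : ℤ => splinePiece_eq_zero) hz]
    exact blochWave_equation_iff hh hB (blochWave_ne_zero μ (L / N) _) ν
  rw [IsPeriodicApproxEigenvalue, funext_iff]
  exact ⟨fun H => (key ⟨0, Nat.pos_of_ne_zero hN⟩).1 (H _), fun H a => (key a).2 H⟩

/-! ### Admissible frequencies of the periodic problem -/

lemma IsPeriodicEigenvalue.exp_eq_one {L lam μ : ℝ} (h : IsPeriodicEigenvalue L lam)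
    (hμ : μ ^ 2 = lam) : Complex.exp (Complex.I * (μ * L)) = 1 := by
  obtain ⟨u, hu0, hu, hper, hode⟩ := h
  rcases eq_or_ne μ 0 with rfl | hμ0
  · simp
  have hu1 : Differentiable ℝ u := hu.differentiable (by norm_num)
  have hu2 : Differentiable ℝ (deriv u) :=
    (contDiff_succ_iff_deriv.1 (show ContDiff ℝ (1 + 1) u from hu)).2.2.differentiable (by norm_num)
  -- One factor of the equation: `v' = iμ v`, so `v` is a multiple of `exp (iμx)`. It is
  -- `L`-periodic, and nonzero because its imaginary part is `μ u`.
  set v : ℝ → ℂ := fun x => ((deriv u x : ℝ) : ℂ) + Complex.I * μ * (u x : ℝ) with hv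
  set w : ℝ → ℂ := fun x => v x * Complex.exp (-(Complex.I * μ) * x) with hw
  have hwd : ∀ x, HasDerivAt w 0 x := by
    intro x
    have h1 : HasDerivAt (fun x => ((deriv u x : ℝ) : ℂ)) ((deriv (deriv u) x : ℝ) : ℂ) x :=
      (hu2 x).hasDerivAt.ofReal_comp
    have h2 : HasDerivAt (fun x => ((u x : ℝ) : ℂ)) ((deriv u x : ℝ) : ℂ) x :=
      (hu1 x).hasDerivAt.ofReal_comp
    have h3 : HasDerivAt (fun x : ℝ => Complex.exp (-(Complex.I * μ) * x))
        (Complex.exp (-(Complex.I * μ) * x) * (-(Complex.I * μ) * 1)) x :=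
      ((hasDerivAt_id x).ofReal_comp.const_mul _).cexp
    have h4 := (h1.add (h2.const_mul (Complex.I * μ))).mul h3
    refine HasDerivAt.congr_deriv (f := w) h4 ?_
    have hx : ((deriv (deriv u) x : ℝ) : ℂ) = -((μ : ℂ) ^ 2 * u x) := by
      have := hode x
      rw [← hμ] at this
      have : deriv (deriv u) x = -(μ ^ 2 * u x) := by linarith
      rw [this]; push_cast; ring
    rw [hx]
    simp only [Pi.add_apply]
    linear_combination (-(Complex.exp (-(Complex.I * μ) * x) * μ ^ 2 * u x)) * Complex.I_sq
  have hconst : ∀ x, w x = w 0 := fun x =>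
    is_const_of_deriv_eq_zero (fun x => (hwd x).differentiableAt) (fun x => (hwd x).deriv) x 0
  have hvper : v L = v 0 := by
    have e1 : u L = u 0 := by simpa using hper 0
    have e2 : deriv u L = deriv u 0 := by
      have : deriv (fun x => u (x + L)) 0 = deriv u 0 := by
        congr 1; exact funext hper
      rwa [deriv_comp_add_const, zero_add] at this
    simp only [hv, e1, e2]
  have hw0 : w 0 = v 0 := by simp [hw]
  have hv0 : v 0 ≠ 0 := by
    intro hv0
    apply hu0
    funext x
    have h1 : v x = 0 := by
      have := hconst x
      rw [hw0, hv0] at this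
      exact (mul_eq_zero.1 this).resolve_right (Complex.exp_ne_zero _)
    have h2 := congrArg Complex.im h1
    simpa [hv, hμ0] using h2
  have hL := hconst L
  rw [hw0] at hL
  simp only [hw, hvper] at hL
  have h5 : Complex.exp (-(Complex.I * μ) * L) = 1 := mul_left_cancel₀ hv0 (by rw [hL, mul_one])
  rw [show -(Complex.I * (μ : ℂ)) * L = -(Complex.I * (μ * L)) by ring, Complex.exp_neg,
    inv_eq_one] at h5
  exact h5

lemma blochWave_periodic {L μ : ℝ} (h : Complex.exp (Complex.I * (μ * L)) = 1) {N : ℕ}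
    (hN : N ≠ 0) (k m : ℤ) :
    blochWave μ (L / N) (k + m * N) = blochWave μ (L / N) k := by
  have hN' : (N : ℂ) ≠ 0 := by exact_mod_cast hN
  have : blochWave μ (L / N) (m * N) = 1 := by
    rw [blochWave, show Complex.I * (((m * N : ℤ) : ℂ) * μ * ((L / N : ℝ) : ℂ)) =
      m * (Complex.I * (μ * L)) by push_cast; field_simp, Complex.exp_int_mul, h, one_zpow]
  rw [blochWave_add, this, mul_one]

/-! ### Taylor expansion of the symbols -/

lemma cos_sub_taylor_isBigO (M : ℕ) :
    (fun x : ℝ => Real.cos x - ∑ m ∈ range M, (-1) ^ m * x ^ (2 * m) / ((2 * m).factorial : ℝ))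
      =O[𝓝 0] fun x : ℝ => x ^ (2 * M) := by
  have hre : ∀ (x : ℝ) (M : ℕ),
      (∑ m ∈ range (2 * M), ((x : ℂ) * Complex.I) ^ m / (m.factorial : ℂ)).re =
      ∑ m ∈ range M, (-1) ^ m * x ^ (2 * m) / ((2 * m).factorial : ℝ) := by
    intro x M
    induction M with
    | zero => simp
    | succ M ih =>
      rw [show 2 * (M + 1) = 2 * M + 1 + 1 by ring, sum_range_succ, sum_range_succ, Complex.add_re,
        Complex.add_re, ih, sum_range_succ]
      have h1 : ((x : ℂ) * Complex.I) ^ (2 * M) / ((2 * M).factorial : ℂ) =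
          (((-1) ^ M * x ^ (2 * M) / ((2 * M).factorial : ℝ) : ℝ) : ℂ) := by
        rw [mul_pow, pow_mul Complex.I, Complex.I_sq]; push_cast; ring
      have h2 : ((x : ℂ) * Complex.I) ^ (2 * M + 1) / ((2 * M + 1).factorial : ℂ) =
          (((-1) ^ M * x ^ (2 * M + 1) / ((2 * M + 1).factorial : ℝ) : ℝ) : ℂ) * Complex.I := by
        rw [mul_pow, pow_succ Complex.I, pow_mul Complex.I, Complex.I_sq]; push_cast; ring
      rw [h1, h2, Complex.ofReal_re, Complex.re_ofReal_mul, Complex.I_re]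
      ring
  refine IsBigO.of_bound (Real.exp 1) ?_
  filter_upwards [Metric.ball_mem_nhds (0 : ℝ) one_pos] with x hx
  have hx1 : |x| ≤ 1 := by
    have := mem_ball_zero_iff.1 hx
    exact (Real.norm_eq_abs x ▸ this).le
  have hn : ‖(x : ℂ) * Complex.I‖ = |x| := by simp
  calc ‖Real.cos x - ∑ m ∈ range M, (-1) ^ m * x ^ (2 * m) / ((2 * m).factorial : ℝ)‖
      = |(Complex.exp ((x : ℂ) * Complex.I) -
          ∑ m ∈ range (2 * M), ((x : ℂ) * Complex.I) ^ m / (m.factorial : ℂ)).re| := by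
        rw [Complex.sub_re, hre, Complex.exp_ofReal_mul_I_re, Real.norm_eq_abs]
    _ ≤ ‖Complex.exp ((x : ℂ) * Complex.I) -
          ∑ m ∈ range (2 * M), ((x : ℂ) * Complex.I) ^ m / (m.factorial : ℂ)‖ :=
        Complex.abs_re_le_norm _
    _ ≤ |x| ^ (2 * M) * Real.exp |x| := by
        rw [← hn]; exact Complex.norm_exp_sub_sum_le_norm_mul_exp _ _
    _ ≤ Real.exp 1 * ‖x ^ (2 * M)‖ := by
        rw [norm_pow, Real.norm_eq_abs, mul_comm]
        gcongr

lemma QuadratureRule.apply_correlation (Q : QuadratureRule) (p : ℕ) (P : ℤ → ℝ[X]) (r : ℕ) :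
    Q.apply (correlation p P r) = ∑ i ∈ range (p + 1), ∑ e ∈ range (p + 1),
      ((e : ℝ) - i) ^ r * Q.apply (P (i : ℤ) * P (e : ℤ)) := by
  simp only [correlation, map_sum, ← smul_eq_C_mul, map_smul, smul_eq_mul]

lemma symbol_sub_taylor_isBigO (Q : QuadratureRule) (p : ℕ) (P : ℤ → ℝ[X]) (M : ℕ) :
    (fun ω : ℝ => symbol Q p P ω - ∑ m ∈ range M,
      (-1) ^ m * Q.apply (correlation p P (2 * m)) * ω ^ (2 * m) / ((2 * m).factorial : ℝ))
      =O[𝓝 0] fun ω : ℝ => ω ^ (2 * M) := by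
  have hrw : (fun ω : ℝ => symbol Q p P ω - ∑ m ∈ range M,
      (-1) ^ m * Q.apply (correlation p P (2 * m)) * ω ^ (2 * m) / ((2 * m).factorial : ℝ)) =
      fun ω => ∑ i ∈ range (p + 1), ∑ e ∈ range (p + 1), Q.apply (P (i : ℤ) * P (e : ℤ)) *
        (Real.cos (((e : ℝ) - i) * ω) - ∑ m ∈ range M,
          (-1) ^ m * (((e : ℝ) - i) * ω) ^ (2 * m) / ((2 * m).factorial : ℝ)) := by
    funext ω
    simp_rw [mul_sub, sum_sub_distrib]
    rw [symbol]
    congr 1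
    simp_rw [Q.apply_correlation, mul_sum, sum_mul, sum_div]
    rw [sum_comm]
    refine sum_congr rfl fun i _ => ?_
    rw [sum_comm]
    refine sum_congr rfl fun e _ => sum_congr rfl fun m _ => ?_
    rw [mul_pow]
    ring
  have hcos : ∀ i e : ℕ, (fun ω : ℝ => Real.cos (((e : ℝ) - i) * ω) - ∑ m ∈ range M,
      (-1) ^ m * (((e : ℝ) - i) * ω) ^ (2 * m) / ((2 * m).factorial : ℝ))
      =O[𝓝 0] fun ω : ℝ => ω ^ (2 * M) := by
    intro i e
    have ht : Tendsto (fun ω : ℝ => ((e : ℝ) - i) * ω) (𝓝 0) (𝓝 0) := by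
      have : Continuous fun ω : ℝ => ((e : ℝ) - i) * ω := by fun_prop
      simpa using this.tendsto 0
    refine ((cos_sub_taylor_isBigO M).comp_tendsto ht).trans ?_
    have : ((fun x : ℝ => x ^ (2 * M)) ∘ fun ω : ℝ => ((e : ℝ) - i) * ω) =
        fun ω => ((e : ℝ) - i) ^ (2 * M) * ω ^ (2 * M) := by
      funext ω; simp [mul_pow]
    rw [this]
    exact isBigO_const_mul_self _ _ _
  rw [hrw]
  exact IsBigO.fun_sum fun i _ => IsBigO.fun_sum fun e _ => (hcos i e).const_mul_left _

lemma QuadratureRule.ExactUpTo.apply_eq {Q : QuadratureRule} {m : ℕ} (hQ : Q.ExactUpTo m)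
    {P : ℝ[X]} (hP : P.natDegree ≤ m) : Q.apply P = integral01 P := hQ P hP

lemma apply_correlation_derivPiece_zero {Q : QuadratureRule} {p : ℕ} (hp : 1 ≤ p)
    (hQ : Q.ExactUpTo (2 * p - 2)) : Q.apply (correlation p (derivPiece p) 0) = 0 := by
  rw [hQ.apply_eq (natDegree_correlation_derivative_le p 0)]
  exact integral01_correlation_derivative_zero hp

lemma apply_correlation_derivPiece {Q : QuadratureRule} {p : ℕ} (hp : 1 ≤ p)
    (hQ : Q.ExactUpTo (2 * p - 2)) {r : ℕ} (hr : r + 2 ≤ 2 * p) :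
    Q.apply (correlation p (derivPiece p) (r + 2)) =
      -((r + 2) * (r + 1)) * Q.apply (correlation p (splinePiece p) r) := by
  rw [hQ.apply_eq (natDegree_correlation_derivative_le p _),
    hQ.apply_eq ((natDegree_correlation_splinePiece_le p r).trans (by omega))]
  exact integral01_correlation_derivative hp hr

lemma apply_correlation_splinePiece_zero {Q : QuadratureRule} {p : ℕ}
    (hQ : Q.ExactUpTo (2 * p - 2)) : Q.apply (correlation p (splinePiece p) 0) = 1 := by
  have h1 : correlation p (splinePiece p) 0 = 1 := by
    have := moment_zero p
    rw [moment] at this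
    rw [correlation_eq]
    simp only [pow_zero, one_mul] at this
    simp [this]
  rw [h1, hQ.apply_eq (by simp)]
  simp [integral01]

/-- The leading coefficient of the dispersion error. -/
def dispersionCoeff (Q : QuadratureRule) (p : ℕ) : ℝ :=
  (-1) ^ (p + 1) * (Q.apply (correlation p (derivPiece p) (2 * p + 2)) /
    ((2 * p + 2).factorial : ℝ) +
    Q.apply (correlation p (splinePiece p) (2 * p)) / ((2 * p).factorial : ℝ))

/-- Shifting `m` by one, the factor `-(r+2)(r+1)` with `r = 2m` is absorbed by the sign and the
factorial, so all orders up to `2p` cancel. Only the last term of each sum survives. -/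
lemma taylor_symbols_eq {Q : QuadratureRule} {p : ℕ} (hp : 1 ≤ p)
    (hQ : Q.ExactUpTo (2 * p - 2)) (ω : ℝ) :
    ∑ m ∈ range (p + 2), (-1) ^ m * Q.apply (correlation p (derivPiece p) (2 * m)) *
        ω ^ (2 * m) / ((2 * m).factorial : ℝ) -
      ω ^ 2 * ∑ m ∈ range (p + 1), (-1) ^ m * Q.apply (correlation p (splinePiece p) (2 * m)) *
        ω ^ (2 * m) / ((2 * m).factorial : ℝ) =
      dispersionCoeff Q p * ω ^ (2 * p + 2) := by
  have hsum : ∑ m ∈ range p, (-1) ^ (m + 1) *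
        Q.apply (correlation p (derivPiece p) (2 * (m + 1))) *
        ω ^ (2 * (m + 1)) / ((2 * (m + 1)).factorial : ℝ) =
      ω ^ 2 * ∑ m ∈ range p, (-1) ^ m * Q.apply (correlation p (splinePiece p) (2 * m)) *
        ω ^ (2 * m) / ((2 * m).factorial : ℝ) := by
    rw [mul_sum]
    refine sum_congr rfl fun m hm => ?_
    have hm := mem_range.1 hm
    rw [show 2 * (m + 1) = 2 * m + 2 by ring, apply_correlation_derivPiece hp hQ (by omega),
      Nat.factorial_succ, Nat.factorial_succ]
    have := Nat.factorial_ne_zero (2 * m)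
    push_cast
    have h1 : (2 * (m : ℝ) + 1 + 1) ≠ 0 := by positivity
    have h2 : (2 * (m : ℝ) + 1) ≠ 0 := by positivity
    have h3 : ((2 * m).factorial : ℝ) ≠ 0 := by exact_mod_cast this
    field_simp
    ring
  rw [sum_range_succ', sum_range_succ, sum_range_succ, hsum, mul_zero,
    apply_correlation_derivPiece_zero hp hQ, dispersionCoeff,
    show 2 * (p + 1) = 2 * p + 2 by ring]
  ring

lemma symbol_dispersion_isBigO {Q : QuadratureRule} {p : ℕ} (hp : 1 ≤ p)
    (hQ : Q.ExactUpTo (2 * p - 2)) :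
    (fun ω : ℝ => symbol Q p (derivPiece p) ω - ω ^ 2 * symbol Q p (splinePiece p) ω -
      dispersionCoeff Q p * ω ^ (2 * p + 2)) =O[𝓝 0] fun ω : ℝ => ω ^ (2 * p + 4) := by
  have hA := symbol_sub_taylor_isBigO Q p (derivPiece p) (p + 2)
  have hB := (isBigO_refl (fun ω : ℝ => ω ^ 2) (𝓝 0)).mul
    (symbol_sub_taylor_isBigO Q p (splinePiece p) (p + 1))
  have e1 : (fun ω : ℝ => ω ^ 2 * ω ^ (2 * (p + 1))) = fun ω => ω ^ (2 * p + 4) := by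
    funext ω; ring
  rw [e1] at hB
  refine (hA.sub hB).congr_left fun ω => ?_
  rw [← taylor_symbols_eq hp hQ]
  ring

lemma symbol_splinePiece_sub_one_isBigO {Q : QuadratureRule} {p : ℕ}
    (hQ : Q.ExactUpTo (2 * p - 2)) :
    (fun ω : ℝ => symbol Q p (splinePiece p) ω - 1) =O[𝓝 0] fun ω : ℝ => ω ^ 2 := by
  simpa [apply_correlation_splinePiece_zero hQ] using
    symbol_sub_taylor_isBigO Q p (splinePiece p) 1

lemma tendsto_symbol_splinePiece {Q : QuadratureRule} {p : ℕ}
    (hQ : Q.ExactUpTo (2 * p - 2)) : Tendsto (symbol Q p (splinePiece p)) (𝓝 0) (𝓝 1) := by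
  have h1 : Tendsto (fun ω : ℝ => ω ^ 2) (𝓝 0) (𝓝 0) := by
    simpa using (continuous_pow 2).tendsto (0 : ℝ)
  have h2 := (symbol_splinePiece_sub_one_isBigO hQ).trans_tendsto h1
  simpa using h2.add_const 1

/-! ### The eigenvalue error -/

/-- The discrete eigenvalue belonging to the frequency `μ`. -/
def discreteEigenvalue (Q : QuadratureRule) (p : ℕ) (μ h : ℝ) : ℝ :=
  symbol Q p (derivPiece p) (μ * h) / (h ^ 2 * symbol Q p (splinePiece p) (μ * h))

lemma tendsto_mul_nhdsGT (μ : ℝ) : Tendsto (fun h : ℝ => μ * h) (𝓝[>] 0) (𝓝 0) := by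
  have : Continuous fun h : ℝ => μ * h := by fun_prop
  simpa using (this.tendsto 0).mono_left nhdsWithin_le_nhds

lemma discreteEigenvalue_isBigO {Q : QuadratureRule} {p : ℕ} (hp : 1 ≤ p)
    (hQ : Q.ExactUpTo (2 * p - 2)) (μ : ℝ) :
    (fun h : ℝ => discreteEigenvalue Q p μ h - μ ^ 2 -
      dispersionCoeff Q p * μ ^ (2 * p + 2) * h ^ (2 * p))
      =O[𝓝[>] 0] fun h : ℝ => h ^ (2 * p + 2) := by
  set A := symbol Q p (derivPiece p)
  set B := symbol Q p (splinePiece p)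
  set D := dispersionCoeff Q p
  have hBt : Tendsto B (𝓝 0) (𝓝 1) := tendsto_symbol_splinePiece hQ
  -- The extra factor `B ω = 1 + O(ω²)` costs only `O(ω^(2p+4))`, and makes the expression exactly
  -- `h² B` times the error.
  have hnum : (fun ω : ℝ => A ω - ω ^ 2 * B ω - D * ω ^ (2 * p + 2) * B ω)
      =O[𝓝 0] fun ω : ℝ => ω ^ (2 * p + 4) := by
    have h1 := symbol_dispersion_isBigO hp hQ
    have h2 := ((isBigO_refl (fun ω : ℝ => ω ^ (2 * p + 2)) (𝓝 0)).const_mul_left D).mul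
      (symbol_splinePiece_sub_one_isBigO (p := p) hQ)
    have e : (fun ω : ℝ => ω ^ (2 * p + 2) * ω ^ 2) = fun ω => ω ^ (2 * p + 4) := by
      funext ω; ring
    rw [e] at h2
    exact (h1.sub h2).congr_left fun ω => by ring
  have hinv : (fun ω : ℝ => (B ω)⁻¹) =O[𝓝 0] fun _ : ℝ => (1 : ℝ) :=
    (hBt.inv₀ one_ne_zero).isBigO_one ℝ
  have hquot := (hnum.mul hinv).comp_tendsto (tendsto_mul_nhdsGT μ)
  have hall := hquot.mul (isBigO_refl (fun h : ℝ => (h ^ 2)⁻¹) (𝓝[>] 0))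
  have hB0 : ∀ᶠ h in 𝓝[>] (0 : ℝ), B (μ * h) ≠ 0 :=
    (hBt.comp (tendsto_mul_nhdsGT μ)).eventually_ne one_ne_zero
  refine (hall.congr' ?_ ?_).trans (isBigO_const_mul_self (μ ^ (2 * p + 4)) _ _)
  · filter_upwards [hB0, self_mem_nhdsWithin] with h hB hh
    have hh' : h ≠ 0 := (Set.mem_Ioi.1 hh).ne'
    simp only [Function.comp_apply, discreteEigenvalue]
    change _ = A (μ * h) / (h ^ 2 * B (μ * h)) - _ - _
    field_simp
    ring
  · filter_upwards [self_mem_nhdsWithin] with h hh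
    have hh' : h ≠ 0 := (Set.mem_Ioi.1 hh).ne'
    simp only [Function.comp_apply]
    field_simp
    ring

lemma gram_neg (Q : QuadratureRule) (P : ℤ → ℝ[X]) (d : ℤ) : gram Q P (-d) = gram Q P d := by
  rw [gram, gram, ← finsum_comp_equiv (Equiv.addRight d)]
  refine finsum_congr fun e => ?_
  rw [Equiv.coe_addRight, add_neg_cancel_right, mul_comm]

/-- Grouping the pairs by `d = e - i` gives Gram entries; for even `r` the summand is even in `d`,
whence the factor `2`, and `r ≠ 0` removes `d = 0`. -/
lemma apply_correlation_eq_sum_gram (Q : QuadratureRule) {p : ℕ} {P : ℤ → ℝ[X]}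
    (hP : ∀ i : ℤ, ¬ (0 ≤ i ∧ i ≤ p) → P i = 0) {r : ℕ} (hr : Even r) (hr0 : r ≠ 0) :
    Q.apply (correlation p P r) = 2 * ∑ k ∈ Finset.Icc 1 p, (k : ℝ) ^ r * gram Q P k := by
  have hinner : ∀ i ∈ range (p + 1), ∑ e ∈ range (p + 1),
      ((e : ℝ) - i) ^ r * Q.apply (P (i : ℤ) * P (e : ℤ)) =
      ∑ d ∈ Finset.Icc (-(p : ℤ)) p, (d : ℝ) ^ r * Q.apply (P (i : ℤ) * P (i + d)) := by
    intro i hi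
    have hi := mem_range.1 hi
    have h0 : ∀ d : ℤ, ¬ (0 ≤ d - -(i : ℤ) ∧ d - -(i : ℤ) ≤ p) →
        (d : ℝ) ^ r * Q.apply (P (i : ℤ) * P (i + d)) = 0 := by
      intro d hd
      rw [hP (i + d) (by omega), mul_zero, map_zero, mul_zero]
    have h1 := finsum_eq_sum_range_shift _ h0
    rw [finsum_eq_sum_of_support_subset (s := Finset.Icc (-(p : ℤ)) p)] at h1
    · rw [h1]
      refine sum_congr rfl fun e _ => ?_
      rw [add_neg_cancel_left]
      push_cast
      ring
    · intro d hd
      by_contra hcon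
      refine hd (h0 d fun h => hcon ?_)
      rw [coe_Icc, Set.mem_Icc]
      omega
  rw [Q.apply_correlation, sum_congr rfl hinner, sum_comm]
  simp_rw [← mul_sum, ← gram_eq_sum Q hP]
  rw [sum_Icc_of_even_eq_range (f := fun d : ℤ => (d : ℝ) ^ r * gram Q P d), Int.cast_zero,
    zero_pow hr0, zero_mul, sub_zero, sum_range_succ', Nat.cast_zero, Int.cast_zero, zero_pow hr0,
    zero_mul, add_zero, nsmul_eq_mul, Nat.cast_ofNat]
  · congr 1
    rw [range_eq_Ico, sum_Ico_add' (fun k : ℕ => ((k : ℤ) : ℝ) ^ r * gram Q P k), zero_add]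
    simp only [Int.cast_natCast]
    rfl
  · intro d
    simp only [gram_neg, Int.cast_neg, hr.neg_pow]

lemma leadingError_eq (Q : QuadratureRule) {p : ℕ} (hp : 1 ≤ p) {h : ℝ} (hh : 0 < h) (j : ℤ)
    (μ : ℝ) : leadingError Q p h j μ = dispersionCoeff Q p * μ ^ (2 * p + 2) * h ^ (2 * p) := by
  rw [dispersionCoeff, leadingError,
    apply_correlation_eq_sum_gram Q (fun _ : ℤ => derivPiece_eq_zero) ⟨p + 1, by ring⟩ (by omega),
    apply_correlation_eq_sum_gram Q (fun _ : ℤ => splinePiece_eq_zero) ⟨p, by ring⟩ (by omega)]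
  simp_rw [stiffnessEntry_eq Q hh hp, massEntry_eq Q hh hp, sum_add_distrib, div_mul_eq_mul_div,
    ← sum_div]
  ring

lemma discreteEigenvalue_sub_leadingError_isBigO {Q : QuadratureRule} {p : ℕ} (hp : 1 ≤ p)
    (hQ : Q.ExactUpTo (2 * p - 2)) (μ : ℝ) (j : ℤ) :
    (fun h : ℝ => discreteEigenvalue Q p μ h - μ ^ 2 - leadingError Q p h j μ)
      =O[𝓝[>] 0] fun h : ℝ => h ^ (2 * p + 2) := by
  refine (discreteEigenvalue_isBigO hp hQ μ).congr' ?_ EventuallyEq.rfl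
  filter_upwards [self_mem_nhdsWithin] with h hh
  rw [leadingError_eq Q hp hh]

lemma eventually_symbol_splinePiece_ne_zero {Q : QuadratureRule} {p : ℕ}
    (hQ : Q.ExactUpTo (2 * p - 2)) (μ : ℝ) :
    ∀ᶠ h in 𝓝[>] (0 : ℝ), symbol Q p (splinePiece p) (μ * h) ≠ 0 :=
  ((tendsto_symbol_splinePiece hQ).comp (tendsto_mul_nhdsGT μ)).eventually_ne one_ne_zero

lemma tendsto_div_natCast_nhdsGT {L : ℝ} (hL : 0 < L) :
    Tendsto (fun N : ℕ => L / (N : ℝ)) atTop (𝓝[>] 0) := by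
  refine tendsto_nhdsWithin_iff.2 ⟨tendsto_const_div_atTop_nhds_zero_nat L, ?_⟩
  filter_upwards [eventually_gt_atTop 0] with N hN
  exact div_pos hL (by exact_mod_cast hN)

end

end IGADispersion

theorem theorem5p1 (p : ℕ) (hp : 1 ≤ p) (Q : QuadratureRule) (hQ : Q.ExactUpTo (2 * p - 2)) :
    (∀ μ : ℝ, ∃ lamh : ℝ → ℝ,
      (∀ᶠ h in 𝓝[>] (0 : ℝ), ∀ ν : ℂ, IsBlochEigenvalue Q p h μ ν ↔ ν = (lamh h : ℂ)) ∧
      ∀ j : ℤ, (fun h : ℝ => lamh h - μ ^ 2 - leadingError Q p h j μ)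
        =O[𝓝[>] (0 : ℝ)] (fun h : ℝ => h ^ (2 * p + 2))) ∧
    (∀ L : ℝ, 0 < L → ∀ lam μ : ℝ, IsPeriodicEigenvalue L lam → μ ^ 2 = lam →
      ∃ lamh : ℕ → ℝ,
        (∀ᶠ N : ℕ in atTop, ∀ ν : ℂ,
          IsPeriodicApproxEigenvalue Q p N L μ ν ↔ ν = (lamh N : ℂ)) ∧
        ∀ j : ℤ, (fun N : ℕ => lamh N - lam - leadingError Q p (L / N) j μ)
          =O[atTop] (fun N : ℕ => (L / N) ^ (2 * p + 2))) := by
  refine ⟨fun μ => ⟨discreteEigenvalue Q p μ, ?_,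
    discreteEigenvalue_sub_leadingError_isBigO hp hQ μ⟩, fun L hL lam μ hlam hμ =>
    ⟨fun N => discreteEigenvalue Q p μ (L / N), ?_, fun j => ?_⟩⟩
  · filter_upwards [eventually_symbol_splinePiece_ne_zero hQ μ, self_mem_nhdsWithin] with h hB hh ν
    exact isBlochEigenvalue_iff Q hh hp μ hB ν
  · filter_upwards [(tendsto_div_natCast_nhdsGT hL).eventually
      (eventually_symbol_splinePiece_ne_zero hQ μ), eventually_ne_atTop 0] with N hB hN ν
    exact isPeriodicApproxEigenvalue_iff Q hp hN hL
      (blochWave_periodic (hlam.exp_eq_one hμ) hN) hB ν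
  · subst hμ
    exact (discreteEigenvalue_sub_leadingError_isBigO hp hQ μ j).comp_tendsto
      (tendsto_div_natCast_nhdsGT hL)
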